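/- Let $k$ be a field, $n\ge 0$ and $S=k[x_1,\dots,x_n]$ with the standard grading. For a monomial ideal $I\subset S$ let $G(I)$ be its minimal system of monomial generators. The \emph{critical} squarefree monomial ideals of $S$ are those obtained recursively as follows: (a) every ideal $(x_i,m)$, with $x_i$ a variable and $m$ a squarefree monomial such that $x_i\nmid m$, is critical; (b) if $J$ is critical, $x_j$ is a variable and $m'$ is a squarefree monomial such that $x_j\nmid mm'$ and $\operatorname{supp}(m)\cap\operatorname{supp}(m')=\emptyset$ for all $m\in G(J)$, then $(x_j)+m'J$ is critical. A squarefree monomial ideal $I$ is \emph{canonical critical} if $I=wJ$ for some monomial $w$ and some critical squarefree monomial ideal $J$. Then: (1) Every critical squarefree monomial ideal $I$ has linear quotients, that is, $G(I)$ can be ordered as $u_1,\dots,u_s$ such that for each $t$ the colon ideal $(u_1,\dots,u_{t-1}):u_t$ is generated by a (possibly empty) set of variables. (2) Every canonical critical squarefree monomial ideal $I$ is componentwise linear, that is, $I$ is graded and for every $j\ge 0$ the ideal $I_{\langle j\rangle}$ generated by all homogeneous polynomials of degree $j$ in $I$ has a linear resolution, i.e. a graded free resolution $\cdots\to S(-j-2)^{b_2}\to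 S(-j-1)^{b_1}\to S(-j)^{b_0}\to I_{\langle j\rangle}\to 0$ with all $b_i$ finite (the zero ideal counts as having a linear resolution). -/

import Mathlib

namespace CriticalIdeal

open MvPolynomial

attribute [local instance] MvPolynomial.gradedAlgebra

/-- The polynomial ring `S = k[x_1, …, x_n]`. A monomial of `S` is represented by its exponent
vector `a : Fin n →₀ ℕ`; divisibility of monomials is the order `≤` on exponent vectors. -/
abbrev S (k : Type*) [Field k] (n : ℕ) := MvPolynomial (Fin n) k

/-- The monomial with exponent vector `a`, as an element of `S`. -/
noncomputable abbrev mon (k : Type*) [Field k] {n : ℕ} (a : Fin n →₀ ℕ) : S k n :=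
  monomial a 1

/-- The monomial with exponent vector `a` is squarefree. -/
def IsSquarefreeMon {n : ℕ} (a : Fin n →₀ ℕ) : Prop := ∀ i, a i ≤ 1

variable {k : Type*} [Field k] {n : ℕ}

/-- `I` is generated by monomials. -/
def IsMonomialIdeal (I : Ideal (S k n)) : Prop :=
  ∃ A : Set (Fin n →₀ ℕ), I = Ideal.span (mon k '' A)

/-- `I` is generated by squarefree monomials. -/
def IsSquarefreeMonomialIdeal (I : Ideal (S k n)) : Prop :=
  ∃ A : Set (Fin n →₀ ℕ), (∀ a ∈ A, IsSquarefreeMon a) ∧ I = Ideal.span (mon k '' A)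

/-- `G(I)`: the monomials of `I` that are minimal with respect to divisibility. For a monomial
ideal this is its unique minimal system of monomial generators. -/
def minGens (I : Ideal (S k n)) : Set (Fin n →₀ ℕ) :=
  {a | Minimal (fun b => mon k b ∈ I) a}

/-- Critical squarefree monomial ideals: `(x_i, m)` with `m` a squarefree monomial, `x_i ∤ m`;
and `(x_j) + m' J` with `J` critical, `m'` a squarefree monomial, `x_j ∤ m m'` and
`supp m ∩ supp m' = ∅` for all `m ∈ G(J)`. -/
inductive IsCritical : Ideal (S k n) → Prop
  | base (i : Fin n) (m : Fin n →₀ ℕ) (hm : IsSquarefreeMon m) (him : m i = 0) :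
      IsCritical (Ideal.span {X i, mon k m})
  | step (j : Fin n) (m' : Fin n →₀ ℕ) (J : Ideal (S k n)) (hJ : IsCritical J)
      (hm' : IsSquarefreeMon m')
      (hj : ∀ m ∈ minGens J, (m + m') j = 0)
      (hdisj : ∀ m ∈ minGens J, Disjoint m.support m'.support) :
      IsCritical (Ideal.span {X j} + Ideal.span {mon k m'} * J)

/-- Canonical critical squarefree monomial ideals: squarefree monomial ideals of the form `w J`
with `w` a monomial and `J` critical. -/
def IsCanonicalCritical (I : Ideal (S k n)) : Prop :=
  IsSquarefreeMonomialIdeal I ∧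
    ∃ (w : Fin n →₀ ℕ) (J : Ideal (S k n)), IsCritical J ∧ I = Ideal.span {mon k w} * J

/-- The monomial ideal `I` has linear quotients: `G(I)` can be ordered as `u_1, …, u_s` such that
each colon ideal `(u_1, …, u_{t-1}) : u_t` is generated by a set of variables. -/
def HasLinearQuotients (I : Ideal (S k n)) : Prop :=
  IsMonomialIdeal I ∧
    ∃ (s : ℕ) (u : Fin s → (Fin n →₀ ℕ)),
      Function.Injective u ∧ Set.range u = minGens I ∧
      ∀ t : Fin s, ∃ V : Set (Fin n),
        (Ideal.span ((fun r => mon k (u r)) '' Set.Iio t)).colon {mon k (u t)} =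
          Ideal.span (X '' V)

/-- A `d`-linear resolution of the ideal `I`: a graded free resolution
`⋯ → S(-d-2)^{ι 2} → S(-d-1)^{ι 1} → S(-d)^{ι 0} → I → 0` with finite index sets `ι i`, given by
matrices. The entries of the augmentation are forms of degree `d`, those of the differentials
are linear forms; in particular such a resolution is minimal. -/
structure LinearResolution (d : ℕ) (I : Ideal (S k n)) where
  /-- The basis of the `i`-th free module, whose elements have degree `d + i`. -/
  ι : ℕ → Type
  /-- The free modules have finite rank. -/
  fintype : ∀ i, Fintype (ι i)
  /-- The augmentation, by the images of the basis elements. -/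
  ε : ι 0 → S k n
  /-- The differentials. -/
  φ : ∀ i, Matrix (ι i) (ι (i + 1)) (S k n)
  ε_homogeneous : ∀ c, (ε c).IsHomogeneous d
  φ_homogeneous : ∀ i r c, (φ i r c).IsHomogeneous 1
  range_ε : LinearMap.range (Fintype.linearCombination (S k n) ε) = I
  exact_zero :
    Function.Exact (φ 0).mulVecLin (Fintype.linearCombination (S k n) ε)
  exact_succ : ∀ i, Function.Exact (φ (i + 1)).mulVecLin (φ i).mulVecLin

/-- `I` has a `d`-linear resolution. -/
def HasLinearResolution (d : ℕ) (I : Ideal (S k n)) : Prop :=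
  Nonempty (LinearResolution d I)

/-- `I_{⟨j⟩}`: the ideal generated by all homogeneous polynomials of degree `j` in `I`. -/
noncomputable def component (I : Ideal (S k n)) (j : ℕ) : Ideal (S k n) :=
  Ideal.span {f | f ∈ I ∧ f.IsHomogeneous j}

/-- The ideal `I` is graded, and each `I_{⟨j⟩}` has a linear resolution. Since `I_{⟨j⟩}` is
generated in degree `j`, this resolution is `j`-linear. -/
def IsComponentwiseLinear (I : Ideal (S k n)) : Prop :=
  I.IsHomogeneous (homogeneousSubmodule (Fin n) k) ∧
    ∀ j, HasLinearResolution j (component I j)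

end CriticalIdeal

/-!
If `I` is generated by forms of degree `d` and has a `d`-linear resolution, and if `u` is a form of
degree `d` whose colon ideal `I : u` has a `1`-linear resolution, then multiplication by `u` lifts
to a chain map from the resolution of `I : u` to that of `I`. Its entries can be chosen to be linear
forms, and its mapping cone is then a `d`-linear resolution of `I + (u)`. Ideals generated by
variables are resolved in this way, and then all ideals with linear quotients generated in a single
degree.

Critical ideals have linear quotients with respect to generators of nondecreasing degrees: this
property survives multiplication by a monomial, and the addition of a variable that occurs in no
generator, which is put in front. If `u_1, …, u_s` is such a system of generators, then the
monomials of degree `d` in the ideal also have linear quotients, once they are sorted by the first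
`u_t` that divides them and then in decreasing lexicographic order. If `w` comes before `a` because
of an earlier `u_r`, then some `u_q` with `q < t` divides `a x_l`, with `x_l` dividing `w : a`.
Since `deg u_q ≤ deg u_t ≤ deg a`, there is a monomial of degree `d` between `u_q` and `a x_l`. If
`u_t` is the first divisor of both, then a factor of `a` is exchanged for the first variable in
which `a` and `w` differ.
-/

namespace CriticalIdeal

open MvPolynomial

attribute [local instance] MvPolynomial.gradedAlgebra

attribute [local instance] LinearResolution.fintype

section Matrices

open Matrix

variable {R α α' β β' γ γ' : Type*} [CommRing R]
  [Fintype β] [Fintype β'] [Fintype γ] [Fintype γ']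

theorem mul_eq_zero_of_exact {A : Matrix α β R} {B : Matrix β γ R}
    (h : Function.Exact B.mulVecLin A.mulVecLin) : A * B = 0 := by
  refine mulVec_injective (funext fun v => ?_)
  rw [← mulVec_mulVec, zero_mulVec]
  exact h.apply_apply_eq_zero v

theorem range_mulVecLin_le_of_exact {A : Matrix α β R} {B : Matrix β γ R} {C : Matrix β γ' R}
    (h : Function.Exact B.mulVecLin A.mulVecLin) (hC : A * C = 0) :
    LinearMap.range C.mulVecLin ≤ LinearMap.range B.mulVecLin := by
  rw [← h.linearMap_ker_eq, LinearMap.range_le_ker_iff, ← mulVecLin_mul, hC, mulVecLin_zero]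

-- Only the kernel of `T` matters, so that this covers both the augmentation and the differentials
-- of a mapping cone.
theorem exact_fromBlocks_of_eq_zero_iff {N : Type*} [Zero N] {A₁ : Matrix α β R}
    {A₂ : Matrix β γ R} {ψ₁ : Matrix α β' R} {ψ₂ : Matrix β γ' R} {C : Matrix β' γ' R}
    {T : (β ⊕ β' → R) → N} (hA : Function.Exact A₂.mulVecLin A₁.mulVecLin)
    (hψ : A₁ * ψ₂ = ψ₁ * C)
    (hT : ∀ x y, T (Sum.elim x y) = 0 ↔
      A₁ *ᵥ x + ψ₁ *ᵥ y = 0 ∧ y ∈ LinearMap.range C.mulVecLin) :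
    Function.Exact (fromBlocks A₂ ψ₂ 0 (-C)).mulVecLin T := by
  have hψ' (z : γ' → R) : A₁ *ᵥ (ψ₂ *ᵥ z) = ψ₁ *ᵥ (C *ᵥ z) := by
    rw [mulVec_mulVec, hψ, mulVec_mulVec]
  have hmul (y : γ → R) (z : γ' → R) : (fromBlocks A₂ ψ₂ 0 (-C)).mulVecLin (Sum.elim y z) =
      Sum.elim (A₂ *ᵥ y + ψ₂ *ᵥ z) (-(C *ᵥ z)) := by
    simp [fromBlocks_mulVec, neg_mulVec]
  intro v
  obtain ⟨x, y, rfl⟩ : ∃ x y, v = Sum.elim x y := ⟨_, _, (Sum.elim_comp_inl_inr v).symm⟩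
  rw [hT]
  constructor
  · rintro ⟨hxy, z, rfl⟩
    obtain ⟨w, hw : A₂ *ᵥ w = x + ψ₂ *ᵥ z⟩ := (hA (x + ψ₂ *ᵥ z)).1 <| by
      rw [mulVecLin_apply, mulVec_add, hψ']
      exact hxy
    exact ⟨Sum.elim w (-z), by simp [hmul, hw, mulVec_neg]⟩
  · rintro ⟨w, hw⟩
    rw [← Sum.elim_comp_inl_inr w, hmul, Sum.elim_eq_iff] at hw
    obtain ⟨rfl, rfl⟩ := hw
    have hzero : A₁ *ᵥ (A₂ *ᵥ (w ∘ Sum.inl)) = 0 := hA.apply_apply_eq_zero _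
    exact ⟨by rw [mulVec_add, hψ', hzero, mulVec_neg, zero_add, add_neg_cancel],
      -(w ∘ Sum.inr), by rw [mulVecLin_apply, mulVec_neg]⟩

theorem exact_fromBlocks {A₁ : Matrix α β R} {A₂ : Matrix β γ R} {C₁ : Matrix α' β' R}
    {C₂ : Matrix β' γ' R} {ψ₁ : Matrix α β' R} {ψ₂ : Matrix β γ' R}
    (hA : Function.Exact A₂.mulVecLin A₁.mulVecLin)
    (hC : Function.Exact C₂.mulVecLin C₁.mulVecLin) (hψ : A₁ * ψ₂ = ψ₁ * C₂) :
    Function.Exact (fromBlocks A₂ ψ₂ 0 (-C₂)).mulVecLin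
      (fromBlocks A₁ ψ₁ 0 (-C₁)).mulVecLin := by
  refine exact_fromBlocks_of_eq_zero_iff hA hψ fun x y => ?_
  rw [← hC.linearMap_ker_eq, LinearMap.mem_ker, mulVecLin_apply, mulVecLin_apply,
    fromBlocks_mulVec, Sum.elim_comp_inl, Sum.elim_comp_inr, zero_mulVec, zero_add, neg_mulVec,
    ← Sum.elim_zero_zero, Sum.elim_eq_iff, neg_eq_zero]

end Matrices

section HomogeneousMatrices

open Matrix

variable {σ R α β γ : Type*} [CommSemiring R] [Fintype β]

theorem homogeneousComponent_add_mul {p : MvPolynomial σ R} {m : ℕ} (hp : p.IsHomogeneous m)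
    (q : MvPolynomial σ R) (e : ℕ) :
    homogeneousComponent (m + e) (p * q) = p * homogeneousComponent e q := by
  rw [← decomposition.decompose'_apply, ← decomposition.decompose'_apply]
  exact DirectSum.coe_decompose_mul_add_of_left_mem (homogeneousSubmodule σ R) hp

theorem isHomogeneous_mul_apply {A : Matrix α β (MvPolynomial σ R)}
    {B : Matrix β γ (MvPolynomial σ R)} {l m : ℕ} (hA : ∀ a b, (A a b).IsHomogeneous l)
    (hB : ∀ b c, (B b c).IsHomogeneous m) (a : α) (c : γ) : ((A * B) a c).IsHomogeneous (l + m) :=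
  .sum _ _ _ fun b _ => (hA a b).mul (hB b c)

theorem exists_isHomogeneous_mul_eq [Fintype γ] {A : Matrix α β (MvPolynomial σ R)}
    {B : Matrix α γ (MvPolynomial σ R)} {m e : ℕ} (hA : ∀ a b, (A a b).IsHomogeneous m)
    (hB : ∀ a c, (B a c).IsHomogeneous (m + e))
    (h : LinearMap.range B.mulVecLin ≤ LinearMap.range A.mulVecLin) :
    ∃ W : Matrix β γ (MvPolynomial σ R), (∀ b c, (W b c).IsHomogeneous e) ∧ A * W = B := by
  classical
  have hcol (c : γ) : ∃ w, A *ᵥ w = B.col c :=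
    h ⟨Pi.single c 1, by rw [mulVecLin_apply, mulVec_single_one]⟩
  choose w hw using hcol
  refine ⟨of fun b c => homogeneousComponent e (w c b),
    fun b c => homogeneousComponent_isHomogeneous e _, ?_⟩
  ext1 a c
  calc (A * of fun b c => homogeneousComponent e (w c b)) a c
      = homogeneousComponent (m + e) (∑ b, A a b * w c b) := by
        simp only [mul_apply, of_apply, map_sum, homogeneousComponent_add_mul (hA a _)]
    _ = homogeneousComponent (m + e) (B a c) := congrArg _ (congrFun (hw c) a)
    _ = B a c := homogeneousComponent_eq_self (hB a c)

end HomogeneousMatrices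

variable {k : Type*} [Field k] {n : ℕ}

namespace LinearResolution

open Matrix

variable {d e : ℕ} {I P : Ideal (S k n)} {u : S k n}

/-- The augmentation of a linear resolution as a matrix with a single row, so that it can be
treated on the same footing as the differentials. -/
def augmentation (R : LinearResolution d I) : Matrix Unit (R.ι 0) (S k n) :=
  replicateRow Unit R.ε

theorem augmentation_mulVec (R : LinearResolution d I) (v : R.ι 0 → S k n) :
    R.augmentation *ᵥ v = fun _ => Fintype.linearCombination (S k n) R.ε v := by
  rw [augmentation, replicateRow_mulVec_eq_const, dotProduct_comm]
  rfl

theorem exact_augmentation (R : LinearResolution d I) :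
    Function.Exact (R.φ 0).mulVecLin R.augmentation.mulVecLin := fun v => by
  rw [← R.exact_zero v, mulVecLin_apply, augmentation_mulVec, funext_iff]
  simp

theorem mem_range_augmentation (R : LinearResolution d I) {v : Unit → S k n} :
    v ∈ LinearMap.range R.augmentation.mulVecLin ↔ v () ∈ I := by
  simp only [LinearMap.mem_range, mulVecLin_apply, augmentation_mulVec, funext_iff,
    ← SetLike.ext_iff.1 R.range_ε (v ()), Unique.forall_iff, PUnit.default_eq_unit]

/-- The matrix `ψ` of linear forms, from the `i`-th module of `K` to that of `R`, admits a lift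
to the next step of the resolutions. -/
def IsLiftable (R : LinearResolution d I) (K : LinearResolution e P) (i : ℕ)
    (ψ : Matrix (R.ι i) (K.ι i) (S k n)) : Prop :=
  (∀ r c, (ψ r c).IsHomogeneous 1) ∧
    LinearMap.range (ψ * K.φ i).mulVecLin ≤ LinearMap.range (R.φ i).mulVecLin

theorem IsLiftable.exists_succ {R : LinearResolution d I} {K : LinearResolution e P} {i : ℕ}
    {ψ : Matrix (R.ι i) (K.ι i) (S k n)} (hψ : IsLiftable R K i ψ) :
    ∃ ψ', IsLiftable R K (i + 1) ψ' ∧ R.φ i * ψ' = ψ * K.φ i := by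
  obtain ⟨ψ', hψ', hmul⟩ := exists_isHomogeneous_mul_eq (R.φ_homogeneous i)
    (isHomogeneous_mul_apply hψ.1 (K.φ_homogeneous i)) hψ.2
  refine ⟨ψ', ⟨hψ', range_mulVecLin_le_of_exact (R.exact_succ i) ?_⟩, hmul⟩
  rw [← Matrix.mul_assoc, hmul, Matrix.mul_assoc, mul_eq_zero_of_exact (K.exact_succ i),
    Matrix.mul_zero]

theorem exists_isLiftable_zero (R : LinearResolution d I) (K : LinearResolution 1 P)
    (hu : u.IsHomogeneous d) (hP : P ≤ I.colon {u}) :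
    ∃ ψ, IsLiftable R K 0 ψ ∧ R.augmentation * ψ = u • K.augmentation := by
  have hrange : LinearMap.range (u • K.augmentation).mulVecLin ≤
      LinearMap.range R.augmentation.mulVecLin := by
    rintro _ ⟨v, rfl⟩
    have hv : (K.augmentation *ᵥ v) () ∈ P := K.mem_range_augmentation.1 ⟨v, rfl⟩
    rw [mem_range_augmentation, mulVecLin_apply, smul_mulVec, Pi.smul_apply, smul_eq_mul, mul_comm]
    exact Submodule.mem_colon_singleton.1 (hP hv)
  obtain ⟨ψ, hψ, hmul⟩ := exists_isHomogeneous_mul_eq (A := R.augmentation)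
    (B := u • K.augmentation) (fun _ => R.ε_homogeneous) (fun _ c => hu.mul (K.ε_homogeneous c))
    hrange
  refine ⟨ψ, ⟨hψ, range_mulVecLin_le_of_exact R.exact_augmentation ?_⟩, hmul⟩
  rw [← Matrix.mul_assoc, hmul, Matrix.smul_mul, mul_eq_zero_of_exact K.exact_augmentation,
    smul_zero]

/-- A homogeneous chain map from a linear resolution of `P` to a linear resolution of `I` that
lifts the multiplication by `u`. -/
structure ComparisonMap (R : LinearResolution d I) (K : LinearResolution 1 P) (u : S k n) where
  /-- The components of the chain map. -/
  ψ : ∀ i, Matrix (R.ι i) (K.ι i) (S k n)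
  ψ_homogeneous : ∀ i r c, (ψ i r c).IsHomogeneous 1
  augmentation_mul_ψ : R.augmentation * ψ 0 = u • K.augmentation
  φ_mul_ψ : ∀ i, R.φ i * ψ (i + 1) = ψ i * K.φ i

theorem nonempty_comparisonMap (R : LinearResolution d I) (K : LinearResolution 1 P)
    (hu : u.IsHomogeneous d) (hP : P ≤ I.colon {u}) : Nonempty (ComparisonMap R K u) := by
  obtain ⟨ψ₀, hψ₀, haug⟩ := exists_isLiftable_zero R K hu hP
  choose lift hlift hmul using fun i (ψ : {ψ // IsLiftable R K i ψ}) => ψ.2.exists_succ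
  let ψ : ∀ i, {ψ // IsLiftable R K i ψ} :=
    Nat.rec ⟨ψ₀, hψ₀⟩ fun i ψᵢ => ⟨lift i ψᵢ, hlift i ψᵢ⟩
  exact ⟨⟨fun i => (ψ i).1, fun i => (ψ i).2.1, haug, fun i => hmul i (ψ i)⟩⟩

theorem range_linearCombination_sumElim (R : LinearResolution d I) :
    LinearMap.range (Fintype.linearCombination (S k n) (Sum.elim R.ε fun _ : Unit => u)) =
      I ⊔ Ideal.span {u} := by
  rw [Fintype.range_linearCombination, Set.Sum.elim_range, Submodule.span_union,
    ← Fintype.range_linearCombination, R.range_ε, Set.range_const]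

namespace ComparisonMap

variable {R : LinearResolution d I}

/-- The bases of the modules in the mapping cone of a comparison map. -/
def coneι (R : LinearResolution d I) (K : LinearResolution e P) : ℕ → Type
  | 0 => R.ι 0 ⊕ Unit
  | i + 1 => R.ι (i + 1) ⊕ K.ι i

instance fintypeConeι (R : LinearResolution d I) (K : LinearResolution e P) :
    ∀ i, Fintype (coneι R K i)
  | 0 => inferInstanceAs (Fintype (R.ι 0 ⊕ Unit))
  | i + 1 => inferInstanceAs (Fintype (R.ι (i + 1) ⊕ K.ι i))

/-- The differentials of the mapping cone of a comparison map. -/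
noncomputable def coneφ {K : LinearResolution 1 P} (f : ComparisonMap R K u) :
    ∀ i, Matrix (coneι R K i) (coneι R K (i + 1)) (S k n)
  | 0 => fromBlocks (R.φ 0) (f.ψ 0) 0 (-K.augmentation)
  | i + 1 => fromBlocks (R.φ (i + 1)) (f.ψ (i + 1)) 0 (-K.φ i)

theorem coneφ_homogeneous {K : LinearResolution 1 P} (f : ComparisonMap R K u) :
    ∀ i r c, (f.coneφ i r c).IsHomogeneous 1
  | 0, .inl r, .inl c => R.φ_homogeneous 0 r c
  | 0, .inl r, .inr c => f.ψ_homogeneous 0 r c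
  | 0, .inr _, .inl _ => isHomogeneous_zero _ _ _
  | 0, .inr _, .inr c => (K.ε_homogeneous c).neg
  | i + 1, .inl r, .inl c => R.φ_homogeneous (i + 1) r c
  | i + 1, .inl r, .inr c => f.ψ_homogeneous (i + 1) r c
  | _ + 1, .inr _, .inl _ => isHomogeneous_zero _ _ _
  | i + 1, .inr r, .inr c => (K.φ_homogeneous i r c).neg

theorem exact_coneφ_zero {K : LinearResolution 1 (I.colon {u})} (f : ComparisonMap R K u) :
    Function.Exact (f.coneφ 0).mulVecLin
      (Fintype.linearCombination (S k n) (Sum.elim R.ε fun _ : Unit => u)) := by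
  refine exact_fromBlocks_of_eq_zero_iff (ψ₁ := u • (1 : Matrix Unit Unit (S k n)))
    R.exact_augmentation ?_ fun x y => ?_
  · rw [f.augmentation_mul_ψ, Matrix.smul_mul, Matrix.one_mul]
  have hsum : Fintype.linearCombination (S k n) (Sum.elim R.ε fun _ : Unit => u) (Sum.elim x y) =
      Fintype.linearCombination (S k n) R.ε x + y () * u := by
    simp [Fintype.linearCombination_apply]
  have haug : R.augmentation *ᵥ x + (u • (1 : Matrix Unit Unit (S k n))) *ᵥ y = 0 ↔
      Fintype.linearCombination (S k n) R.ε x + y () * u = 0 := by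
    simp [augmentation_mulVec, smul_mulVec, funext_iff, mul_comm, Unique.forall_iff]
  rw [hsum, haug, K.mem_range_augmentation, Submodule.mem_colon_singleton, smul_eq_mul]
  refine ⟨fun h => ⟨h, ?_⟩, And.left⟩
  rw [eq_neg_of_add_eq_zero_right h]
  exact I.neg_mem ((SetLike.ext_iff.1 R.range_ε _).1 ⟨x, rfl⟩)

theorem exact_coneφ_succ {K : LinearResolution 1 P} (f : ComparisonMap R K u) :
    ∀ i, Function.Exact (f.coneφ (i + 1)).mulVecLin (f.coneφ i).mulVecLin
  | 0 => exact_fromBlocks (R.exact_succ 0) K.exact_augmentation (f.φ_mul_ψ 0)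
  | i + 1 => exact_fromBlocks (R.exact_succ (i + 1)) (K.exact_succ i) (f.φ_mul_ψ (i + 1))

/-- The mapping cone of a comparison map from a linear resolution of the colon ideal `I : u`, as a
linear resolution of `I + (u)`. -/
noncomputable def cone {K : LinearResolution 1 (I.colon {u})} (f : ComparisonMap R K u)
    (hu : u.IsHomogeneous d) : LinearResolution d (I ⊔ Ideal.span {u}) where
  ι := coneι R K
  fintype := fintypeConeι R K
  ε := Sum.elim R.ε fun _ => u
  φ := f.coneφ
  ε_homogeneous := Sum.rec R.ε_homogeneous fun _ => hu
  φ_homogeneous := f.coneφ_homogeneous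
  range_ε := R.range_linearCombination_sumElim
  exact_zero := f.exact_coneφ_zero
  exact_succ := f.exact_coneφ_succ

end ComparisonMap

end LinearResolution

theorem HasLinearResolution.sup_span_singleton {d : ℕ} {I : Ideal (S k n)} {u : S k n}
    (hI : HasLinearResolution d I) (hu : u.IsHomogeneous d)
    (hcolon : HasLinearResolution 1 (I.colon {u})) :
    HasLinearResolution d (I ⊔ Ideal.span {u}) := by
  obtain ⟨R⟩ := hI
  obtain ⟨K⟩ := hcolon
  obtain ⟨f⟩ := R.nonempty_comparisonMap K hu le_rfl
  exact ⟨f.cone hu⟩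

theorem hasLinearResolution_bot (d : ℕ) : HasLinearResolution d (⊥ : Ideal (S k n)) :=
  ⟨{ ι := fun _ => Empty
     fintype := fun _ => inferInstance
     ε := Empty.elim
     φ := fun _ => 0
     ε_homogeneous := fun c => c.elim
     φ_homogeneous := fun _ c => c.elim
     range_ε := by rw [Fintype.range_linearCombination, Set.range_eq_empty, Submodule.span_empty]
     exact_zero := fun _ => ⟨fun _ => ⟨0, Subsingleton.elim _ _⟩, fun _ => by
      simp [Fintype.linearCombination_apply]⟩
     exact_succ := fun _ _ => ⟨fun _ => ⟨0, Subsingleton.elim _ _⟩, fun _ =>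
      Subsingleton.elim _ _⟩ }⟩

section Monomials

variable {σ R : Type*} [CommSemiring R] {A : Set (σ →₀ ℕ)} {u : σ →₀ ℕ}

theorem monomial_mem_span_monomial_image_iff [Nontrivial R] :
    monomial u (1 : R) ∈ Ideal.span ((fun b => monomial b (1 : R)) '' A) ↔ ∃ b ∈ A, b ≤ u := by
  classical
  rw [mem_ideal_span_monomial_image, support_monomial, if_neg one_ne_zero]
  simp only [Finset.mem_singleton, forall_eq]

theorem mul_monomial_mem_span_monomial_image_iff {f : MvPolynomial σ R} :
    f * monomial u 1 ∈ Ideal.span ((fun b => monomial b (1 : R)) '' A) ↔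
      ∀ c ∈ f.support, ∃ w ∈ A, w ≤ c + u := by
  have hsupport : (f * monomial u 1).support = f.support.map (addRightEmbedding u) :=
    AddMonoidAlgebra.support_coeff_mul_single f _ (by simp) _
  rw [mem_ideal_span_monomial_image, hsupport]
  simp only [Finset.forall_mem_map, addRightEmbedding_apply]

theorem colon_span_monomial_image
    (h : ∀ w ∈ A, ∃ w' ∈ A, ∃ l, w' ≤ u + Finsupp.single l 1 ∧ u l < w l) :
    (Ideal.span ((fun b => monomial b (1 : R)) '' A)).colon {monomial u 1} =
      Ideal.span (X '' {l | ∃ w ∈ A, w ≤ u + Finsupp.single l 1}) := by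
  ext f
  rw [Submodule.mem_colon_singleton, smul_eq_mul, mul_monomial_mem_span_monomial_image_iff,
    mem_ideal_span_X_image]
  refine forall₂_congr fun c _ => ⟨?_, ?_⟩
  · rintro ⟨w, hw, hwc⟩
    obtain ⟨w', hw', l, hl, hlt⟩ := h w hw
    have hwl : w l ≤ c l + u l := hwc l
    exact ⟨l, ⟨w', hw', hl⟩, by omega⟩
  · rintro ⟨l, ⟨w, hw, hwl⟩, hl⟩
    have hlc : Finsupp.single l 1 ≤ c := Finsupp.single_le_iff.2 (Nat.one_le_iff_ne_zero.2 hl)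
    exact ⟨w, hw, hwl.trans ((add_le_add_right hlc u).trans_eq (add_comm u c))⟩

theorem colon_span_X_image_singleton {V : Set σ} {a : σ} (ha : a ∉ V) :
    (Ideal.span (X '' V) : Ideal (MvPolynomial σ R)).colon {X a} = Ideal.span (X '' V) := by
  ext f
  rw [Submodule.mem_colon_singleton, smul_eq_mul, mem_ideal_span_X_image, mem_ideal_span_X_image,
    support_mul_X, Finset.forall_mem_map]
  refine forall₂_congr fun c _ => exists_congr fun i => and_congr_right fun hi => ?_
  rw [addRightEmbedding_apply, Finsupp.add_apply,
    Finsupp.single_eq_of_ne (ne_of_mem_of_not_mem hi ha), add_zero]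

end Monomials

section Exponents

open Finsupp

variable {σ : Type*} {a b v w : σ →₀ ℕ}

theorem add_single_le {p : σ} (h : a ≤ b) (hp : a p < b p) : a + single p 1 ≤ b := by
  intro i
  rcases eq_or_ne i p with rfl | hi
  · rwa [Finsupp.add_apply, single_eq_same]
  · rw [Finsupp.add_apply, single_eq_of_ne hi]
    exact h i

theorem eq_of_le_of_degree_le (h : a ≤ b) (hd : b.degree ≤ a.degree) : a = b := by
  obtain ⟨c, rfl⟩ := exists_add_of_le h
  have hc : c.degree = 0 := by
    rw [map_add] at hd
    omega
  rw [(degree_eq_zero_iff c).1 hc, add_zero]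

theorem exists_degree_eq_of_le {m : ℕ} (h : v ≤ b) (hv : v.degree ≤ m) (hb : m ≤ b.degree) :
    ∃ a, a.degree = m ∧ v ≤ a ∧ a ≤ b := by
  obtain ⟨c, rfl⟩ := exists_add_of_le h
  rw [map_add] at hb
  obtain ⟨g, hg, hdeg⟩ := c.exists_le_degree_eq (m - v.degree) (by omega)
  exact ⟨v + g, by rw [map_add]; omega, le_self_add, add_le_add_right hg v⟩

theorem exists_exchange_of_lex_lt [LinearOrder σ] (hva : v ≤ a) (hvw : v ≤ w)
    (hdeg : a.degree = w.degree) (hlt : toLex a < toLex w) :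
    ∃ a', a'.degree = a.degree ∧ v ≤ a' ∧ toLex a < toLex a' ∧
      ∃ q, a' ≤ a + single q 1 ∧ a q < w q := by
  obtain ⟨q, heq, hq⟩ := Lex.lt_iff.1 hlt
  obtain ⟨p, hp⟩ : ∃ p, w p < a p := by
    by_contra! hle
    exact hlt.ne (congrArg toLex (eq_of_le_of_degree_le hle hdeg.ge))
  have hqp : q < p := by
    rcases lt_trichotomy p q with h | rfl | h
    · exact absurd (heq p h) hp.ne'
    · exact absurd hp hq.not_gt
    · exact h
  have hvp : v + single p 1 ≤ a := add_single_le hva ((hvw p).trans_lt hp)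
  obtain ⟨c, rfl⟩ := exists_add_of_le (le_add_self.trans hvp)
  rw [add_comm v, add_le_add_iff_left] at hvp
  refine ⟨single q 1 + c, by simp only [map_add, degree_single], hvp.trans le_add_self,
    add_lt_add_left (Lex.single_lt_iff.2 hqp) (toLex c), q, ?_, hq⟩
  rw [add_comm _ (single q 1)]
  exact add_le_add_right le_add_self _

end Exponents

section LinearQuotientFamily

open Finsupp

variable {σ ι : Type*}

/-- A family of exponent vectors which has linear quotients and whose degrees are nondecreasing:
each colon `u r : u t` with `r < t` is divisible by a variable of the form `u q : u t` with
`q < t`. -/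
structure IsLinearQuotientFamily [Preorder ι] (u : ι → σ →₀ ℕ) : Prop where
  degree_mono : Monotone fun t => (u t).degree
  exists_variable : ∀ ⦃r t⦄, r < t → ∃ q < t, ∃ l, u q ≤ u t + single l 1 ∧ u t l < u r l

namespace IsLinearQuotientFamily

theorem add_left [Preorder ι] {u : ι → σ →₀ ℕ} (hu : IsLinearQuotientFamily u) (w : σ →₀ ℕ) :
    IsLinearQuotientFamily fun t => w + u t where
  degree_mono r t h := by
    simpa only [map_add, add_le_add_iff_left] using hu.degree_mono h
  exists_variable r t h := by
    obtain ⟨q, hq, l, hle, hlt⟩ := hu.exists_variable h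
    refine ⟨q, hq, l, ?_, Nat.add_lt_add_left hlt _⟩
    rw [add_assoc]
    exact add_le_add_right hle w

theorem cons_single {s : ℕ} {u : Fin s → σ →₀ ℕ} (hu : IsLinearQuotientFamily u) {j : σ}
    (hj : ∀ t, u t j = 0) (hne : ∀ t, u t ≠ 0) :
    IsLinearQuotientFamily (Fin.cons (single j 1) u : Fin (s + 1) → σ →₀ ℕ) where
  degree_mono := by
    refine Fin.cases (fun t _ => ?_) fun r => Fin.cases (fun h => ?_) fun t h => ?_
    · induction t using Fin.cases with
      | zero => rfl
      | succ t =>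
        simpa only [Fin.cons_zero, Fin.cons_succ, degree_single, Nat.one_le_iff_ne_zero, ne_eq,
          degree_eq_zero_iff] using hne t
    · exact absurd h (Fin.succ_pos r).not_ge
    · exact hu.degree_mono (Fin.succ_le_succ_iff.1 h)
  exists_variable := by
    refine Fin.cases (Fin.cases (fun h => absurd h (lt_irrefl 0)) fun t h => ?_) fun r =>
      Fin.cases (fun h => absurd h (Fin.not_lt_zero _)) fun t h => ?_
    · refine ⟨0, h, j, le_add_self, ?_⟩
      rw [Fin.cons_zero, Fin.cons_succ, hj, single_eq_same]
      exact one_pos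
    · obtain ⟨q, hq, hl⟩ := hu.exists_variable (Fin.succ_lt_succ_iff.1 h)
      exact ⟨q.succ, Fin.succ_lt_succ_iff.2 hq, hl⟩

theorem exists_exchange [Preorder ι] {u : ι → σ →₀ ℕ} (hu : IsLinearQuotientFamily u) {r t : ι}
    {a w : σ →₀ ℕ} (hrt : r < t) (hta : u t ≤ a) (hmin : ∀ q < t, ¬ u q ≤ a) (hrw : u r ≤ w) :
    ∃ a', a'.degree = a.degree ∧ (∃ q < t, u q ≤ a') ∧ ∃ l, a' ≤ a + single l 1 ∧ a l < w l := by
  obtain ⟨q, hq, l, hql, hl⟩ := hu.exists_variable hrt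
  have hal : a l ≤ u t l := by
    by_contra! h
    exact hmin q hq (hql.trans (add_single_le hta h))
  obtain ⟨a', hdeg, hqa', ha'⟩ := exists_degree_eq_of_le (hql.trans (add_le_add_left hta _))
    ((hu.degree_mono hq.le).trans (Finsupp.degree_mono hta)) (Finsupp.degree_mono le_self_add)
  exact ⟨a', hdeg, ⟨q, hq, hqa'⟩, l, ha', hal.trans_lt (hl.trans_le (hrw l))⟩

variable [LinearOrder ι] {u : ι → σ →₀ ℕ}

theorem eq_of_le (hu : IsLinearQuotientFamily u) {r t : ι} (h : u r ≤ u t) : r = t := by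
  rcases lt_trichotomy r t with hrt | rfl | htr
  · obtain ⟨-, -, l, -, hl⟩ := hu.exists_variable hrt
    exact absurd (h l) hl.not_ge
  · rfl
  · obtain ⟨-, -, l, -, hl⟩ := hu.exists_variable htr
    exact absurd (congrArg (· l) (eq_of_le_of_degree_le h (hu.degree_mono htr.le))) hl.ne

theorem exists_colon_eq {R : Type*} [CommSemiring R] (hu : IsLinearQuotientFamily u) (t : ι) :
    ∃ V : Set σ, (Ideal.span ((fun r => monomial (u r) (1 : R)) '' Set.Iio t)).colon
      {monomial (u t) 1} = Ideal.span (X '' V) := by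
  rw [← Set.image_image (fun b => monomial b (1 : R)) u]
  refine ⟨_, colon_span_monomial_image ?_⟩
  rintro _ ⟨r, hr, rfl⟩
  obtain ⟨q, hq, hl⟩ := hu.exists_variable hr
  exact ⟨u q, ⟨q, hq, rfl⟩, hl⟩

end IsLinearQuotientFamily

section Component

variable [Fintype ι] [LinearOrder ι] (u : ι → σ →₀ ℕ) {a w : σ →₀ ℕ} {t : ι}

open Classical in
/-- The first index of a member of the family `u` that divides `a`, or `⊤` if there is none. -/
noncomputable def firstDivisor (a : σ →₀ ℕ) : WithTop ι :=
  (Finset.univ.filter (u · ≤ a)).min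

variable {u}

theorem firstDivisor_le (h : u t ≤ a) : firstDivisor u a ≤ t :=
  Finset.min_le (Finset.mem_filter.2 ⟨Finset.mem_univ t, h⟩)

open Classical in
theorem exists_firstDivisor_eq (h : ∃ t, u t ≤ a) : ∃ t : ι, firstDivisor u a = t ∧ u t ≤ a := by
  obtain ⟨t, ht⟩ := h
  obtain ⟨q, hq⟩ := Finset.min_of_mem (s := Finset.univ.filter (u · ≤ a))
    (Finset.mem_filter.2 ⟨Finset.mem_univ t, ht⟩)
  exact ⟨q, hq, (Finset.mem_filter.1 (Finset.mem_of_min hq)).2⟩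

variable (u) in
/-- The key by which the monomials of a fixed degree are sorted: first by the index of their first
divisor in the family `u`, then in decreasing lexicographic order. -/
noncomputable def componentKey (a : σ →₀ ℕ) : WithTop ι ×ₗ (Lex (σ →₀ ℕ))ᵒᵈ :=
  toLex (firstDivisor u a, OrderDual.toDual (toLex a))

theorem componentKey_injective : Function.Injective (componentKey u) := fun _ _ h =>
  toLex.injective (OrderDual.toDual.injective (Prod.ext_iff.1 (toLex.injective h)).2)

theorem componentKey_lt_iff [LinearOrder σ] : componentKey u a < componentKey u w ↔
    firstDivisor u a < firstDivisor u w ∨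
      firstDivisor u a = firstDivisor u w ∧ toLex w < toLex a :=
  Prod.Lex.toLex_lt_toLex

theorem IsLinearQuotientFamily.exists_componentKey_lt [LinearOrder σ]
    (hu : IsLinearQuotientFamily u) (ha : ∃ t, u t ≤ a) (hw : ∃ t, u t ≤ w)
    (hdeg : a.degree = w.degree) (hlt : componentKey u w < componentKey u a) :
    ∃ a', a'.degree = a.degree ∧ (∃ t, u t ≤ a') ∧ componentKey u a' < componentKey u a ∧
      ∃ l, a' ≤ a + single l 1 ∧ a l < w l := by
  obtain ⟨t, ht, hta⟩ := exists_firstDivisor_eq ha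
  obtain ⟨r, hr, hrw⟩ := exists_firstDivisor_eq hw
  simp only [componentKey_lt_iff, ht, hr, WithTop.coe_lt_coe, WithTop.coe_inj] at hlt ⊢
  rcases hlt with hrt | ⟨rfl, hlex⟩
  · have hmin (q : ι) (hq : q < t) : ¬ u q ≤ a := fun hqa =>
      (ht ▸ firstDivisor_le hqa).not_gt (WithTop.coe_lt_coe.2 hq)
    obtain ⟨a', hdeg', ⟨q, hq, hqa'⟩, hl⟩ := hu.exists_exchange hrt hta hmin hrw
    exact ⟨a', hdeg', ⟨q, hqa'⟩,
      .inl ((firstDivisor_le hqa').trans_lt (WithTop.coe_lt_coe.2 hq)), hl⟩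
  · obtain ⟨a', hdeg', hra', hlex', hl⟩ := exists_exchange_of_lex_lt hta hrw hdeg hlex
    exact ⟨a', hdeg', ⟨r, hra'⟩,
      (firstDivisor_le hra').lt_or_eq.imp_right fun h => ⟨h, hlex'⟩, hl⟩

variable (u) in
/-- The monomials of degree `d` in the ideal generated by the family `u`, sorted by
`componentKey`. A separate type keeps this order apart from divisibility. -/
def ComponentMonomial (d : ℕ) : Type _ :=
  {a : σ →₀ ℕ // a.degree = d ∧ ∃ t, u t ≤ a}

noncomputable instance [LinearOrder σ] (d : ℕ) : LinearOrder (ComponentMonomial u d) :=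
  LinearOrder.lift' (fun a => componentKey u a.1)
    (componentKey_injective.comp Subtype.val_injective)

instance [Finite σ] (d : ℕ) : Finite (ComponentMonomial u d) :=
  ((finite_of_degree_eq d).subset fun _ ha => ha.1).to_subtype

theorem IsLinearQuotientFamily.componentMonomial [LinearOrder σ] (hu : IsLinearQuotientFamily u)
    (d : ℕ) : IsLinearQuotientFamily fun a : ComponentMonomial u d => a.1 where
  degree_mono a b _ := (a.2.1.trans b.2.1.symm).le
  exists_variable w a hlt := by
    obtain ⟨a', hdeg, hmem, hlt', hl⟩ :=
      hu.exists_componentKey_lt a.2.2 w.2.2 (a.2.1.trans w.2.1.symm) hlt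
    exact ⟨⟨a', hdeg.trans a.2.1, hmem⟩, hlt', hl⟩

end Component

end LinearQuotientFamily

section LinearQuotients

variable {d : ℕ}

theorem hasLinearResolution_span_X (V : Set (Fin n)) :
    HasLinearResolution 1 (Ideal.span (X '' V) : Ideal (S k n)) := by
  induction V, V.toFinite using Set.Finite.induction_on with
  | empty => simpa only [Set.image_empty, Ideal.span_empty] using hasLinearResolution_bot 1
  | @insert a V ha _ ih =>
    rw [Set.image_insert_eq, Ideal.span_insert, sup_comm]
    refine ih.sup_span_singleton (isHomogeneous_X k a) ?_
    rwa [colon_span_X_image_singleton ha]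

theorem hasLinearResolution_span_range_of_colon_eq {ι : Type*} [Finite ι] [LinearOrder ι]
    {f : ι → S k n} (hf : ∀ t, (f t).IsHomogeneous d)
    (hcolon : ∀ t, ∃ V : Set (Fin n),
      (Ideal.span (f '' Set.Iio t)).colon {f t} = Ideal.span (X '' V)) :
    HasLinearResolution d (Ideal.span (Set.range f)) := by
  suffices h : ∀ s : Finset ι, IsLowerSet (s : Set ι) →
      HasLinearResolution d (Ideal.span (f '' s)) by
    have := Fintype.ofFinite ι
    simpa only [Finset.coe_univ, Set.image_univ] using
      h Finset.univ (by simpa only [Finset.coe_univ] using isLowerSet_univ)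
  intro s hs
  induction s using Finset.induction_on_max with
  | empty => simpa only [Finset.coe_empty, Set.image_empty, Ideal.span_empty] using
      hasLinearResolution_bot d
  | insert t s hlt ih =>
    have hs_eq : (s : Set ι) = Set.Iio t := by
      ext r
      refine ⟨hlt r, fun hr => ?_⟩
      exact Finset.mem_of_mem_insert_of_ne (hs (le_of_lt hr) (Finset.mem_insert_self t s)) hr.ne
    obtain ⟨V, hV⟩ := hcolon t
    rw [Finset.coe_insert, Set.image_insert_eq, Ideal.span_insert, sup_comm]
    refine (ih (hs_eq ▸ isLowerSet_Iio t)).sup_span_singleton (hf t) ?_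
    rw [hs_eq, hV]
    exact hasLinearResolution_span_X V

theorem component_span_mon (A : Set (Fin n →₀ ℕ)) (d : ℕ) :
    component (Ideal.span (mon k '' A)) d =
      Ideal.span (mon k '' {a | a.degree = d ∧ ∃ b ∈ A, b ≤ a}) := by
  apply le_antisymm <;> rw [component, Ideal.span_le]
  · rintro f ⟨hf, hd⟩
    rw [mem_ideal_span_monomial_image] at hf
    refine mem_ideal_span_monomial_image.2 fun c hc => ⟨c, ⟨?_, hf c hc⟩, le_rfl⟩
    rw [Finsupp.degree_eq_weight_one]
    exact hd (mem_support_iff.1 hc)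
  · rintro _ ⟨a, ⟨ha, hb⟩, rfl⟩
    exact Ideal.subset_span
      ⟨monomial_mem_span_monomial_image_iff.2 hb, isHomogeneous_monomial 1 ha⟩

theorem IsLinearQuotientFamily.hasLinearResolution_component {ι : Type*} [Finite ι]
    [LinearOrder ι] {u : ι → Fin n →₀ ℕ} (hu : IsLinearQuotientFamily u) (d : ℕ) :
    HasLinearResolution d (component (Ideal.span (mon k '' Set.range u)) d) := by
  have := Fintype.ofFinite ι
  have hrange : mon k '' {a | a.degree = d ∧ ∃ b ∈ Set.range u, b ≤ a} =
      Set.range fun a : ComponentMonomial u d => mon k a.1 := by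
    simp only [Set.exists_range_iff, Set.image_eq_range]
    rfl
  rw [component_span_mon, hrange]
  exact hasLinearResolution_span_range_of_colon_eq (fun a => isHomogeneous_monomial 1 a.2.1)
    (hu.componentMonomial d).exists_colon_eq

end LinearQuotients

section MinimalGenerators

theorem minGens_span_mon_range {ι : Type*} {u : ι → Fin n →₀ ℕ}
    (hu : ∀ ⦃r t⦄, u r ≤ u t → r = t) :
    minGens (Ideal.span (mon k '' Set.range u)) = Set.range u := by
  ext a
  simp only [minGens, Set.mem_ofPred_eq, Minimal, monomial_mem_span_monomial_image_iff,
    Set.exists_range_iff]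
  constructor
  · rintro ⟨⟨t, ht⟩, h⟩
    exact ⟨t, le_antisymm ht (h ⟨t, le_rfl⟩ ht)⟩
  · rintro ⟨t, rfl⟩
    refine ⟨⟨t, le_rfl⟩, fun b ⟨r, hr⟩ hb => ?_⟩
    rwa [hu (hr.trans hb)] at hr

theorem minGens_top : minGens (⊤ : Ideal (S k n)) = {0} := by
  ext a
  simp only [minGens, Set.mem_ofPred_eq, Submodule.mem_top, minimal_true, isMin_iff_eq_bot,
    Set.mem_singleton_iff]
  rfl

theorem mon_mem_span_mon_mul_iff {w b : Fin n →₀ ℕ} {I : Ideal (S k n)} :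
    mon k b ∈ Ideal.span {mon k w} * I ↔ ∃ c, w + c = b ∧ mon k c ∈ I := by
  have hmul (c : Fin n →₀ ℕ) : mon k w * mon k c = mon k (w + c) := by
    rw [monomial_mul, one_mul]
  rw [Ideal.mem_span_singleton_mul]
  constructor
  · rintro ⟨z, hz, hzb⟩
    have hwb : w ≤ b := by
      have hdvd : mon k w ∣ mon k b := ⟨z, hzb.symm⟩
      simpa using hdvd
    obtain ⟨c, rfl⟩ := exists_add_of_le hwb
    rw [← hmul] at hzb
    exact ⟨c, rfl, mul_left_cancel₀ (by simp) hzb ▸ hz⟩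
  · rintro ⟨c, rfl, hc⟩
    exact ⟨mon k c, hc, hmul c⟩

theorem minGens_span_mon_mul (w : Fin n →₀ ℕ) (I : Ideal (S k n)) :
    minGens (Ideal.span {mon k w} * I) = (w + ·) '' minGens I := by
  ext b
  simp only [minGens, Set.mem_ofPred_eq, Minimal, mon_mem_span_mon_mul_iff, Set.mem_image]
  constructor
  · rintro ⟨⟨c, rfl, hc⟩, hmin⟩
    refine ⟨c, ⟨hc, fun c' hc' hle => ?_⟩, rfl⟩
    exact le_of_add_le_add_left (hmin ⟨c', rfl, hc'⟩ (add_le_add_right hle w))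
  · rintro ⟨c, ⟨hc, hmin⟩, rfl⟩
    refine ⟨⟨c, rfl, hc⟩, ?_⟩
    rintro _ ⟨c', rfl, hc'⟩ hle
    exact add_le_add_right (hmin hc' (le_of_add_le_add_left hle)) w

end MinimalGenerators

section CriticalIdeals

variable {I : Ideal (S k n)}

/-- `I` is generated by a finite family of monomials of nondecreasing degrees which has linear
quotients. -/
def HasMonotoneLinearQuotients (I : Ideal (S k n)) : Prop :=
  ∃ (s : ℕ) (u : Fin s → Fin n →₀ ℕ),
    IsLinearQuotientFamily u ∧ I = Ideal.span (mon k '' Set.range u)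

namespace HasMonotoneLinearQuotients

theorem top : HasMonotoneLinearQuotients (⊤ : Ideal (S k n)) := by
  refine ⟨1, fun _ => 0, ⟨fun _ _ _ => le_rfl, fun r t h => absurd h (by omega)⟩, ?_⟩
  rw [eq_comm, Ideal.eq_top_iff_one]
  exact monomial_mem_span_monomial_image_iff.2 ⟨0, ⟨0, rfl⟩, le_rfl⟩

theorem mon_mul (hI : HasMonotoneLinearQuotients I) (w : Fin n →₀ ℕ) :
    HasMonotoneLinearQuotients (Ideal.span {mon k w} * I) := by
  obtain ⟨s, u, hu, rfl⟩ := hI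
  refine ⟨s, _, hu.add_left w, ?_⟩
  rw [Ideal.span_mul_span', Set.singleton_mul, Set.image_image, ← Set.range_comp, ← Set.range_comp]
  simp only [Function.comp_def, monomial_mul, one_mul]

theorem X_add (hI : HasMonotoneLinearQuotients I) {j : Fin n} (hj : ∀ m ∈ minGens I, m j = 0) :
    HasMonotoneLinearQuotients (Ideal.span {X j} + I) := by
  obtain ⟨s, u, hu, rfl⟩ := hI
  rw [minGens_span_mon_range fun _ _ => hu.eq_of_le, Set.forall_mem_range] at hj
  by_cases h0 : ∃ t, u t = 0
  · obtain ⟨t, ht⟩ := h0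
    convert top
    rw [Ideal.eq_top_iff_one]
    exact Ideal.mem_sup_right (monomial_mem_span_monomial_image_iff.2 ⟨0, ⟨t, ht⟩, le_rfl⟩)
  · refine ⟨s + 1, _, hu.cons_single hj (not_exists.1 h0), ?_⟩
    rw [Fin.range_cons, Set.image_insert_eq, Ideal.span_insert]
    rfl

theorem hasLinearQuotients (hI : HasMonotoneLinearQuotients I) : HasLinearQuotients I := by
  obtain ⟨s, u, hu, rfl⟩ := hI
  exact ⟨⟨_, rfl⟩, s, u, fun _ _ h => hu.eq_of_le h.le,
    (minGens_span_mon_range fun _ _ => hu.eq_of_le).symm, hu.exists_colon_eq⟩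

theorem isComponentwiseLinear (hI : HasMonotoneLinearQuotients I) : IsComponentwiseLinear I := by
  obtain ⟨s, u, hu, rfl⟩ := hI
  refine ⟨Ideal.homogeneous_span _ _ ?_, fun d => hu.hasLinearResolution_component d⟩
  rintro _ ⟨a, -, rfl⟩
  exact ⟨a.degree, isHomogeneous_monomial 1 rfl⟩

end HasMonotoneLinearQuotients

/-- The ideals obtained from the unit ideal by multiplying by arbitrary monomials and by adding
variables that do not occur in the minimal generators. They include the critical and the canonical
critical squarefree monomial ideals. -/
inductive IsGeneralizedCritical : Ideal (S k n) → Prop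
  | top : IsGeneralizedCritical ⊤
  | mon_mul (w : Fin n →₀ ℕ) {I : Ideal (S k n)} (hI : IsGeneralizedCritical I) :
      IsGeneralizedCritical (Ideal.span {mon k w} * I)
  | X_add (j : Fin n) {I : Ideal (S k n)} (hI : IsGeneralizedCritical I)
      (hj : ∀ m ∈ minGens I, m j = 0) : IsGeneralizedCritical (Ideal.span {X j} + I)

theorem IsGeneralizedCritical.hasMonotoneLinearQuotients (hI : IsGeneralizedCritical I) :
    HasMonotoneLinearQuotients I := by
  induction hI with
  | top => exact .top
  | mon_mul w _ ih => exact ih.mon_mul w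
  | X_add j _ hj ih => exact ih.X_add hj

theorem IsGeneralizedCritical.X_add_mon_mul (hI : IsGeneralizedCritical I) {j : Fin n}
    {w : Fin n →₀ ℕ} (hj : ∀ m ∈ minGens I, (m + w) j = 0) :
    IsGeneralizedCritical (Ideal.span {X j} + Ideal.span {mon k w} * I) := by
  refine (hI.mon_mul w).X_add j ?_
  rw [minGens_span_mon_mul, Set.forall_mem_image]
  exact fun m hm => add_comm w m ▸ hj m hm

theorem IsCritical.isGeneralizedCritical (hI : IsCritical I) : IsGeneralizedCritical I := by
  induction hI with
  | base i m _ him =>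
    rw [Ideal.span_insert, ← Ideal.mul_top (Ideal.span {mon k m})]
    refine IsGeneralizedCritical.top.X_add_mon_mul ?_
    rw [minGens_top]
    rintro _ rfl
    rwa [zero_add]
  | step j m' J _ _ hj _ ih => exact ih.X_add_mon_mul hj

end CriticalIdeals

end CriticalIdeal

theorem mainTheorem5_general {k : Type*} [Field k] {n : ℕ} {I : Ideal (CriticalIdeal.S k n)}
    (hI : CriticalIdeal.IsGeneralizedCritical I) :
    CriticalIdeal.HasLinearQuotients I ∧ CriticalIdeal.IsComponentwiseLinear I :=
  ⟨hI.hasMonotoneLinearQuotients.hasLinearQuotients,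
    hI.hasMonotoneLinearQuotients.isComponentwiseLinear⟩

theorem mainTheorem5 {k : Type*} [Field k] {n : ℕ} :
    (∀ I : Ideal (CriticalIdeal.S k n),
      CriticalIdeal.IsCritical I → CriticalIdeal.HasLinearQuotients I) ∧
    (∀ I : Ideal (CriticalIdeal.S k n),
      CriticalIdeal.IsCanonicalCritical I → CriticalIdeal.IsComponentwiseLinear I) := by
  refine ⟨fun I hI => (mainTheorem5_general hI.isGeneralizedCritical).1, ?_⟩
  rintro _ ⟨-, w, J, hJ, rfl⟩
  exact (mainTheorem5_general (hJ.isGeneralizedCritical.mon_mul w)).2
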